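/- Let $X$ be a Riemann surface (Hausdorff, not necessarily compact or connected) and let $\sigma : X \to X$ be an anti-holomorphic involution; for instance, $X$ may be the orientation double cover of a compact connected nonorientable Klein surface and $\sigma$ its change-of-orientation involution. For a holomorphic line bundle $L$ over $X$, let $\overline{L}$ be the conjugate complex line bundle (the same real rank two bundle, with the opposite complex structure on each fiber), and equip $\sigma^*\overline{L}$ with the holomorphic structure for which, if $f_{i,j} : U_i \cap U_j \to \mathbb{C}^*$ are holomorphic transition functions of $L$, then the functions $\overline{f_{i,j}\circ\sigma}$ on $\sigma^{-1}(U_i\cap U_j)$ are holomorphic transition functions of $\sigma^*\overline{L}$. For a divisor $D=\sum_j m_j x_j$ (a finite formal sum of points $x_j \in X$ with $m_j \in \mathbb{Z}$), let $\sigma(D) = \sum_j m_j\,\sigma(x_j)$, and let $\mathcal{O}_X(D)$ be the holomorphic line bundle with transition functions $f_j/f_i$, where the $f_i$ are local meromorphic equations of $D$ (so that the $f_i$ are the local expressions of a meromorphic section with divisor $D$). Let $D$ be a divisor on $X$ and let $L$ be a holomorphic line bundle over $X$ that is isomorphic to $\mathcal{O}_X(D)$. Then $\sigma^*\overline{L}$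 is isomorphic, as a holomorphic line bundle, to $\mathcal{O}_X(\sigma(D))$. In particular, $\sigma^*\overline{\mathcal{O}_X(D)} \cong \mathcal{O}_X(\sigma(D))$. -/

import Mathlib

open Bundle Set Topology
open scoped Manifold ContDiff ComplexConjugate

noncomputable section

/-! ### Anti-holomorphic maps of Riemann surfaces -/

section Antiholomorphic

variable {X Y : Type*} [TopologicalSpace X] [ChartedSpace ℂ X]
  [TopologicalSpace Y] [ChartedSpace ℂ Y]

/-- A map of Riemann surfaces is anti-holomorphic if it is continuous and, near every point,
the complex conjugate of its expression in a holomorphic coordinate of the target is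
holomorphic. -/
structure IsAntiholomorphic (σ : X → Y) : Prop where
  continuous : Continuous σ
  contMDiffAt_conj : ∀ x, ContMDiffAt 𝓘(ℂ) 𝓘(ℂ) ω (fun y => conj (chartAt ℂ (σ x) (σ y))) x

theorem AnalyticAt.conj_comp_conj {F : ℂ → ℂ} {z : ℂ} (h : AnalyticAt ℂ F z) :
    AnalyticAt ℂ (fun w => conj (F (conj w))) (conj z) := by
  rw [Complex.analyticAt_iff_eventually_differentiableAt] at h ⊢
  have ht : Filter.Tendsto (fun w : ℂ => conj w) (𝓝 (conj z)) (𝓝 z) := by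
    have := (Complex.continuous_conj.tendsto (conj z))
    simpa using this
  filter_upwards [ht.eventually h] with w hw
  have := hw.conj_conj
  simpa [Function.comp_def] using this

/-- If `σ` is anti-holomorphic and `f` is holomorphic, then the conjugate of `f ∘ σ` is
holomorphic. -/
theorem IsAntiholomorphic.contMDiffAt_conj_comp [IsManifold 𝓘(ℂ) ω Y]
    {σ : X → Y} (hσ : IsAntiholomorphic σ) {f : Y → ℂ} {x : X}
    (hf : ContMDiffAt 𝓘(ℂ) 𝓘(ℂ) ω f (σ x)) :
    ContMDiffAt 𝓘(ℂ) 𝓘(ℂ) ω (fun y => conj (f (σ y))) x := by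
  set c := chartAt ℂ (σ x) with hc
  have hmem : σ x ∈ c.source := mem_chart_source ℂ (σ x)
  have hsymm : ContMDiffAt 𝓘(ℂ) 𝓘(ℂ) ω c.symm (c (σ x)) :=
    (contMDiffOn_chart_symm (I := 𝓘(ℂ)) (n := ω) (x := σ x)).contMDiffAt
      (c.open_target.mem_nhds (c.map_source hmem))
  have hF : ContMDiffAt 𝓘(ℂ) 𝓘(ℂ) ω (f ∘ c.symm) (c (σ x)) := by
    refine ContMDiffAt.comp _ ?_ hsymm
    rwa [c.left_inv hmem]
  have hFa : AnalyticAt ℂ (f ∘ c.symm) (c (σ x)) := hF.contDiffAt.analyticAt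
  have hG : ContMDiffAt 𝓘(ℂ) 𝓘(ℂ) ω (fun w => conj ((f ∘ c.symm) (conj w)))
      (conj (c (σ x))) := hFa.conj_comp_conj.contDiffAt.contMDiffAt
  refine (ContMDiffAt.comp x hG (hσ.contMDiffAt_conj x)).congr_of_eventuallyEq ?_
  filter_upwards [hσ.continuous.continuousAt.preimage_mem_nhds (c.open_source.mem_nhds hmem)]
    with y hy
  have hy' : σ y ∈ c.source := hy
  simp [← hc, c.left_inv hy']

end Antiholomorphic

/-! ### The conjugate of a complex line bundle -/

section Conjugate

variable {X : Type*}

/-- The conjugate bundle: the same fibers, with the opposite complex structure, that is,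
`c` acts as `conj c` did before. -/
def ConjBundle (E : X → Type*) : X → Type _ := fun x => E x

namespace ConjBundle

variable (E : X → Type*)

instance [∀ x, AddCommMonoid (E x)] (x : X) : AddCommMonoid (ConjBundle E x) :=
  inferInstanceAs (AddCommMonoid (E x))

instance [∀ x, AddCommMonoid (E x)] [∀ x, Module ℂ (E x)] (x : X) :
    Module ℂ (ConjBundle E x) :=
  Module.compHom (E x) (starRingEnd ℂ)

instance [∀ x, TopologicalSpace (E x)] (x : X) : TopologicalSpace (ConjBundle E x) :=
  inferInstanceAs (TopologicalSpace (E x))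

/-- The identity map from the total space of the conjugate bundle to that of the bundle. -/
def toOrig : TotalSpace ℂ (ConjBundle E) ≃ TotalSpace ℂ E where
  toFun p := ⟨p.1, p.2⟩
  invFun p := ⟨p.1, p.2⟩
  left_inv _ := rfl
  right_inv _ := rfl

variable [TopologicalSpace (TotalSpace ℂ E)]

instance : TopologicalSpace (TotalSpace ℂ (ConjBundle E)) :=
  TopologicalSpace.induced (toOrig E) inferInstance

/-- The total spaces of a bundle and of its conjugate are the same topological space. -/
def homeomorphOrig : TotalSpace ℂ (ConjBundle E) ≃ₜ TotalSpace ℂ E :=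
  (toOrig E).toHomeomorphOfIsInducing ⟨rfl⟩

/-- Complex conjugation as a homeomorphism of `ℂ`. -/
def conjHomeomorph : ℂ ≃ₜ ℂ := Complex.conjCLE.toHomeomorph

variable {E} [TopologicalSpace X]

/-- A local trivialization of `E`, followed by complex conjugation on `ℂ`, is one of the conjugate
bundle. -/
def conjTriv (e : Trivialization ℂ (π ℂ E)) : Trivialization ℂ (π ℂ (ConjBundle E)) :=
  ((e.compHomeomorph (homeomorphOrig E)).transFiberHomeomorph conjHomeomorph :
    Trivialization ℂ (π ℂ E ∘ homeomorphOrig E))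

theorem conjTriv_baseSet (e : Trivialization ℂ (π ℂ E)) : (conjTriv e).baseSet = e.baseSet := rfl

theorem conjTriv_apply (e : Trivialization ℂ (π ℂ E)) (p : TotalSpace ℂ (ConjBundle E)) :
    conjTriv e p = ((e ⟨p.1, p.2⟩).1, conj (e ⟨p.1, p.2⟩).2) := rfl

theorem conjTriv_symm_apply (e : Trivialization ℂ (π ℂ E)) (p : X × ℂ) :
    (conjTriv e).toOpenPartialHomeomorph.symm p =
      (toOrig E).symm (e.toOpenPartialHomeomorph.symm (p.1, conj p.2)) := rfl

variable (E) in
instance [∀ x, TopologicalSpace (E x)] [FiberBundle ℂ E] : FiberBundle ℂ (ConjBundle E) where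
  totalSpaceMk_isInducing' b :=
    (homeomorphOrig E).isInducing.of_comp_iff.1 (FiberBundle.totalSpaceMk_isInducing ℂ E b)
  trivializationAtlas' :=
    {e' | ∃ (e : Trivialization ℂ (π ℂ E)) (_ : MemTrivializationAtlas e), e' = conjTriv e}
  trivializationAt' x := conjTriv (trivializationAt ℂ E x)
  mem_baseSet_trivializationAt' x := FiberBundle.mem_baseSet_trivializationAt ℂ E x
  trivialization_mem_atlas' x := ⟨trivializationAt ℂ E x, inferInstance, rfl⟩

variable [∀ x, AddCommMonoid (E x)] [∀ x, Module ℂ (E x)]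

instance conjTriv_isLinear (e : Trivialization ℂ (π ℂ E)) [he : e.IsLinear ℂ] :
    (conjTriv e).IsLinear ℂ where
  linear b hb :=
    { map_add := fun v w => by
        have := (he.linear b hb).map_add v w
        exact (congrArg conj this).trans (map_add _ _ _)
      map_smul := fun c v => by
        have := (he.linear b hb).map_smul (conj c) v
        refine (congrArg conj this).trans ?_
        simp [conjTriv_apply] }

theorem conjTriv_coordChangeL (e e' : Trivialization ℂ (π ℂ E)) [e.IsLinear ℂ] [e'.IsLinear ℂ]
    {b : X} (hb : b ∈ e.baseSet ∩ e'.baseSet) (v : ℂ) :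
    (conjTriv e).coordChangeL ℂ (conjTriv e') b v = conj (e.coordChangeL ℂ e' b (conj v)) := by
  rw [Trivialization.coordChangeL_apply' _ _ (by exact hb),
    Trivialization.coordChangeL_apply' _ _ hb]
  rfl

theorem conjTriv_coordChangeL_eq (e e' : Trivialization ℂ (π ℂ E)) [e.IsLinear ℂ] [e'.IsLinear ℂ]
    {b : X} (hb : b ∈ e.baseSet ∩ e'.baseSet) :
    ((conjTriv e).coordChangeL ℂ (conjTriv e') b : ℂ →L[ℂ] ℂ) =
      ContinuousLinearMap.toSpanSingleton ℂ (conj (e.coordChangeL ℂ e' b 1)) := by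
  ext
  simp [conjTriv_coordChangeL e e' hb]

variable (E) in
instance [∀ x, TopologicalSpace (E x)] [FiberBundle ℂ E] [VectorBundle ℂ ℂ E] :
    VectorBundle ℂ ℂ (ConjBundle E) where
  trivialization_linear' := by
    rintro _ ⟨e, he, rfl⟩
    infer_instance
  continuousOn_coordChange' := by
    rintro _ _ ⟨e, he, rfl⟩ ⟨e', he', rfl⟩
    have h1 : ContinuousOn (fun b => (e.coordChangeL ℂ e' b : ℂ →L[ℂ] ℂ) 1)
        (e.baseSet ∩ e'.baseSet) :=
      (continuousOn_coordChange ℂ e e').clm_apply continuousOn_const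
    have h2 := (ContinuousLinearMap.toSpanSingletonCLE (𝕜 := ℂ) (E := ℂ)).continuous.comp_continuousOn
      (Complex.continuous_conj.comp_continuousOn h1)
    exact h2.congr fun b hb => conjTriv_coordChangeL_eq e e' hb

end ConjBundle

end Conjugate

/-! ### Holomorphic line bundles -/

/-- A holomorphic line bundle over a Riemann surface `X`: a complex line bundle over `X` with an
atlas of local trivializations whose transition functions are holomorphic. -/
structure HolomorphicLineBundle (X : Type*) [TopologicalSpace X] [ChartedSpace ℂ X] where
  Fiber : X → Type*
  [addCommMonoid : ∀ x, AddCommMonoid (Fiber x)]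
  [module : ∀ x, Module ℂ (Fiber x)]
  [topologicalSpaceFiber : ∀ x, TopologicalSpace (Fiber x)]
  [topologicalSpaceTotal : TopologicalSpace (TotalSpace ℂ Fiber)]
  [fiberBundle : FiberBundle ℂ Fiber]
  [vectorBundle : VectorBundle ℂ ℂ Fiber]
  [contMDiffVectorBundle : ContMDiffVectorBundle ω ℂ Fiber 𝓘(ℂ)]

namespace HolomorphicLineBundle

attribute [instance] addCommMonoid module topologicalSpaceFiber topologicalSpaceTotal
  fiberBundle vectorBundle contMDiffVectorBundle

variable {X : Type*} [TopologicalSpace X] [ChartedSpace ℂ X]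

/-- An isomorphism of holomorphic line bundles over `X`: a family of complex linear isomorphisms of
the fibers that is holomorphic, with holomorphic inverse, as a map of total spaces. -/
structure Iso (L M : HolomorphicLineBundle X) where
  fiberEquiv : ∀ x, L.Fiber x ≃ₗ[ℂ] M.Fiber x
  holomorphic_toFun : ContMDiff (𝓘(ℂ).prod 𝓘(ℂ)) (𝓘(ℂ).prod 𝓘(ℂ)) ω
    (fun p : TotalSpace ℂ L.Fiber => (⟨p.1, fiberEquiv p.1 p.2⟩ : TotalSpace ℂ M.Fiber))
  holomorphic_invFun : ContMDiff (𝓘(ℂ).prod 𝓘(ℂ)) (𝓘(ℂ).prod 𝓘(ℂ)) ω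
    (fun p : TotalSpace ℂ M.Fiber => (⟨p.1, (fiberEquiv p.1).symm p.2⟩ : TotalSpace ℂ L.Fiber))

/-- For `σ` anti-holomorphic, the transition functions of the pullback of the conjugate bundle,
which are the functions `conj (f ∘ σ)` for `f` a transition function of `L`, are holomorphic. -/
theorem contMDiffVectorBundle_conjPullback [IsManifold 𝓘(ℂ) ω X] (L : HolomorphicLineBundle X)
    (σ : C(X, X)) (hσ : IsAntiholomorphic σ) :
    ContMDiffVectorBundle ω ℂ ((σ : X → X) *ᵖ (ConjBundle L.Fiber)) 𝓘(ℂ) where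
  contMDiffOn_coordChangeL := by
    rintro _ _ ⟨_, ⟨e, he, rfl⟩, rfl⟩ ⟨_, ⟨e', he', rfl⟩, rfl⟩
    have h1 : ∀ x, σ x ∈ e.baseSet ∩ e'.baseSet → ContMDiffAt 𝓘(ℂ) 𝓘(ℂ) ω
        (fun b => conj ((e.coordChangeL ℂ e' (σ b) : ℂ →L[ℂ] ℂ) 1)) x := fun x hx =>
      hσ.contMDiffAt_conj_comp (f := fun b => (e.coordChangeL ℂ e' b : ℂ →L[ℂ] ℂ) 1)
        ((contMDiffAt_coordChangeL hx.1 hx.2).clm_apply contMDiffAt_const)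
    have h2 : ContMDiff 𝓘(ℂ) 𝓘(ℂ, ℂ →L[ℂ] ℂ) ω
        (ContinuousLinearMap.toSpanSingletonCLE (𝕜 := ℂ) (E := ℂ)) :=
      (ContinuousLinearMap.toSpanSingletonCLE (𝕜 := ℂ) (E := ℂ)).contDiff.contMDiff
    intro x hx
    refine ((h2.contMDiffAt.comp x (h1 x hx)).contMDiffWithinAt).congr_of_mem ?_ hx
    intro b hb
    refine Eq.trans ?_ (ConjBundle.conjTriv_coordChangeL_eq e e' (b := σ b) hb)
    ext
    rw [ContinuousLinearEquiv.coe_coe, ContinuousLinearEquiv.coe_coe,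
      Trivialization.coordChangeL_apply' _ _ (by exact hb),
      Trivialization.coordChangeL_apply _ _ (by exact hb)]
    rfl

/-- The holomorphic line bundle `σ^* L̄`. -/
def conjPullback [IsManifold 𝓘(ℂ) ω X] (L : HolomorphicLineBundle X)
    (σ : C(X, X)) (hσ : IsAntiholomorphic σ) : HolomorphicLineBundle X :=
  haveI := L.contMDiffVectorBundle_conjPullback σ hσ
  { Fiber := (σ : X → X) *ᵖ (ConjBundle L.Fiber) }

end HolomorphicLineBundle

/-! ### The line bundle of a divisor -/

section Divisor

variable {X : Type*} [TopologicalSpace X] [ChartedSpace ℂ X]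

/-- A divisor: a finite formal sum of points with integer coefficients. -/
abbrev RiemannDivisor (X : Type*) : Type _ := X →₀ ℤ

namespace RiemannDivisor

/-- The divisor `σ(D) = ∑ nₓ σ(x)` for `D = ∑ nₓ x`. -/
def map (σ : X → X) (D : RiemannDivisor X) : RiemannDivisor X := Finsupp.mapDomain σ D

/-- The coordinate neighbourhood of `i`, with the points of the support of `D` other than `i`
removed. -/
def nbhd (D : RiemannDivisor X) (i : X) : Set X :=
  (chartAt ℂ i).source \ ((D.support : Set X) \ {i})

/-- The local equation `(z - z(i)) ^ D(i)` of `D` on `D.nbhd i`, where `z` is the preferred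
coordinate at `i`: a meromorphic function there, whose divisor is the restriction of `D`. -/
def localEq (D : RiemannDivisor X) (i : X) (y : X) : ℂ :=
  (chartAt ℂ i y - chartAt ℂ i i) ^ D i

/-- The transition function `fⱼ / fᵢ` on `D.nbhd i ∩ D.nbhd j`, where `fᵢ` is the local equation of
`D` at `i`. For `i ≠ j` neither function has a zero or a pole there; for `i = j` the quotient
is `1`. -/
def transition (D : RiemannDivisor X) (i j : X) (y : X) : ℂ :=
  open Classical in if i = j then 1 else D.localEq j y / D.localEq i y

theorem mem_nbhd_self (D : RiemannDivisor X) (i : X) : i ∈ D.nbhd i :=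
  ⟨mem_chart_source ℂ i, fun h => h.2 rfl⟩

theorem isOpen_nbhd [T1Space X] (D : RiemannDivisor X) (i : X) : IsOpen (D.nbhd i) :=
  (chartAt ℂ i).open_source.sdiff (D.support.finite_toSet.subset sdiff_subset).isClosed

theorem localEq_base_ne_zero {D : RiemannDivisor X} {i y : X} (hy : y ∈ D.nbhd i) (hD : D y = 0) :
    D i = 0 ∨ chartAt ℂ i y - chartAt ℂ i i ≠ 0 := by
  by_cases h : D i = 0
  · exact Or.inl h
  · refine Or.inr (sub_ne_zero.2 fun he => h ?_)
    rwa [(chartAt ℂ i).injOn hy.1 (mem_chart_source ℂ i) he] at hD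

theorem localEq_ne_zero {D : RiemannDivisor X} {i y : X} (hy : y ∈ D.nbhd i) (hD : D y = 0) :
    D.localEq i y ≠ 0 := by
  rcases localEq_base_ne_zero hy hD with h | h
  · simp [localEq, h]
  · exact zpow_ne_zero _ h

/-- A point that lies in the neighbourhoods of two different points is not in the support. -/
theorem apply_eq_zero {D : RiemannDivisor X} {i j y : X} (hij : i ≠ j) (hi : y ∈ D.nbhd i)
    (hj : y ∈ D.nbhd j) : D y = 0 := by
  by_contra h
  have hs : y ∈ (D.support : Set X) := by simpa using h
  have h1 : y = i := by_contra fun h => hi.2 ⟨hs, h⟩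
  have h2 : y = j := by_contra fun h => hj.2 ⟨hs, h⟩
  exact hij (h1.symm.trans h2)

theorem contMDiffAt_localEq [IsManifold 𝓘(ℂ) ω X] {D : RiemannDivisor X} {i y : X}
    (hy : y ∈ D.nbhd i) (hD : D y = 0) : ContMDiffAt 𝓘(ℂ) 𝓘(ℂ) ω (D.localEq i) y := by
  rcases localEq_base_ne_zero hy hD with h | h
  · have : D.localEq i = fun _ => (1 : ℂ) := by ext; simp [localEq, h]
    rw [this]
    exact contMDiffAt_const
  · have hc : ContMDiffAt 𝓘(ℂ) 𝓘(ℂ) ω (chartAt ℂ i) y :=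
      (contMDiffOn_chart (I := 𝓘(ℂ)) (n := ω) (x := i)).contMDiffAt
        ((chartAt ℂ i).open_source.mem_nhds hy.1)
    have ha : AnalyticAt ℂ (fun z : ℂ => (z - chartAt ℂ i i) ^ D i) (chartAt ℂ i y) :=
      (analyticAt_id.sub analyticAt_const).zpow h
    exact ha.contDiffAt.contMDiffAt.comp y hc

theorem contMDiffOn_transition [IsManifold 𝓘(ℂ) ω X] (D : RiemannDivisor X) (i j : X) :
    ContMDiffOn 𝓘(ℂ) 𝓘(ℂ) ω (D.transition i j) (D.nbhd i ∩ D.nbhd j) := by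
  classical
  by_cases hij : i = j
  · have : D.transition i j = fun _ => (1 : ℂ) := by ext; simp [transition, hij]
    rw [this]
    exact contMDiffOn_const
  · have : D.transition i j = fun y => D.localEq j y / D.localEq i y := by
      ext; simp [transition, hij]
    rw [this]
    intro y hy
    have hD := apply_eq_zero hij hy.1 hy.2
    exact ((contMDiffAt_localEq hy.2 hD).div₀ (contMDiffAt_localEq hy.1 hD)
      (localEq_ne_zero hy.1 hD)).contMDiffWithinAt

theorem transition_mul (D : RiemannDivisor X) {i j k y : X} (hi : y ∈ D.nbhd i)
    (hj : y ∈ D.nbhd j) (hk : y ∈ D.nbhd k) :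
    D.transition i j y * D.transition j k y = D.transition i k y := by
  classical
  by_cases hij : i = j
  · subst hij; simp [transition]
  by_cases hjk : j = k
  · subst hjk; simp [transition]
  have hD := apply_eq_zero hij hi hj
  have h1 := localEq_ne_zero hi hD
  have h2 := localEq_ne_zero hj hD
  by_cases hik : i = k
  · subst hik
    simp only [transition, if_neg hij, if_neg hjk, if_true]
    field_simp
  · simp only [transition, if_neg hij, if_neg hjk, if_neg hik]
    field_simp

theorem contMDiffOn_toSpanSingleton_transition [IsManifold 𝓘(ℂ) ω X] (D : RiemannDivisor X) (i j : X) :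
    ContMDiffOn 𝓘(ℂ) 𝓘(ℂ, ℂ →L[ℂ] ℂ) ω
      (fun y => ContinuousLinearMap.toSpanSingleton ℂ (D.transition i j y))
      (D.nbhd i ∩ D.nbhd j) :=
  (ContinuousLinearMap.toSpanSingletonCLE (𝕜 := ℂ) (E := ℂ)).contDiff.contMDiff.comp_contMDiffOn
    (D.contMDiffOn_transition i j)

variable [T1Space X] [IsManifold 𝓘(ℂ) ω X]

/-- The cocycle of `𝒪_X(D)`: a vector with coordinate `v` over `D.nbhd i` has coordinate
`(fⱼ / fᵢ) v` over `D.nbhd j`. So the functions `fᵢ` are the coordinates of a meromorphic section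
with divisor `D`. -/
def bundleCore (D : RiemannDivisor X) : VectorBundleCore ℂ X ℂ X where
  baseSet := D.nbhd
  isOpen_baseSet := D.isOpen_nbhd
  indexAt := id
  mem_baseSet_at := D.mem_nbhd_self
  coordChange i j y := ContinuousLinearMap.toSpanSingleton ℂ (D.transition i j y)
  coordChange_self i y _ v := by simp [transition]
  continuousOn_coordChange i j := (D.contMDiffOn_toSpanSingleton_transition i j).continuousOn
  coordChange_comp i j k y hy v := by
    simp [← D.transition_mul hy.1.1 hy.1.2 hy.2, mul_assoc]

instance (D : RiemannDivisor X) : D.bundleCore.IsContMDiff 𝓘(ℂ) ω where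
  contMDiffOn_coordChange := D.contMDiffOn_toSpanSingleton_transition

/-- The holomorphic line bundle `𝒪_X(D)`. -/
def lineBundle (D : RiemannDivisor X) : HolomorphicLineBundle X where
  Fiber := D.bundleCore.Fiber

end RiemannDivisor

end Divisor

end

/-! The isomorphism carries the canonical meromorphic section of `σ^* 𝒪_X(D)‾` to that of
`𝒪_X(σ(D))`. Let `z_x` be the preferred coordinate at `x`, centred at `x`. Near `x` the first
section has the coordinate `conj (z_{σ x} ∘ σ) ^ D(σ x)`, the second `z_x ^ D(σ x)`, because `σ` is
its own inverse.

Since `σ` is an anti-holomorphic involution, `conj (z_{σ x} ∘ σ)` is again a local coordinate at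
`x`, so it equals `h_x * z_x` with `h_x` holomorphic and `h_x(x) ≠ 0`
(`IsAntiholomorphic.exists_factor_chart`). Multiplication by `h_x ^ (-D(σ x))` therefore takes one
local equation to the other, and these multiplications glue
(`nonempty_iso_conjPullback_lineBundle`).

The case of general `L` follows because `L ↦ σ^* L̄` respects isomorphisms: a local coefficient `u`
becomes `conj (u ∘ σ)`, which is again holomorphic (`Iso.conjPullback`). -/

/-! ### Quotients of holomorphic coordinates -/

section Coordinates

variable {X : Type*} [TopologicalSpace X] [ChartedSpace ℂ X]

/-- The difference quotient of a holomorphic function with respect to a coordinate extends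
holomorphically to the base point. -/
theorem exists_contMDiffAt_factor_chart [IsManifold 𝓘(ℂ) ω X] {f : X → ℂ} {x : X}
    (hf : ContMDiffAt 𝓘(ℂ) 𝓘(ℂ) ω f x) :
    ∃ h : X → ℂ, ContMDiffAt 𝓘(ℂ) 𝓘(ℂ) ω h x ∧
      ∀ᶠ y in 𝓝 x, f y - f x = h y * (chartAt ℂ x y - chartAt ℂ x x) := by
  set c := chartAt ℂ x with hc
  have hmem : x ∈ c.source := mem_chart_source ℂ x
  have hsymm : ContMDiffAt 𝓘(ℂ) 𝓘(ℂ) ω c.symm (c x) :=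
    (contMDiffOn_chart_symm (I := 𝓘(ℂ)) (n := ω) (x := x)).contMDiffAt
      (c.open_target.mem_nhds (c.map_source hmem))
  have hF : ContMDiffAt 𝓘(ℂ) 𝓘(ℂ) ω (f ∘ c.symm) (c x) := by
    refine ContMDiffAt.comp _ ?_ hsymm
    rwa [c.left_inv hmem]
  -- Removable singularity: shifting the power series of `f ∘ c.symm` by one degree gives one for
  -- the difference quotient.
  obtain ⟨p, hp⟩ := hF.contDiffAt.analyticAt
  have hG : AnalyticAt ℂ (dslope (f ∘ c.symm) (c x)) (c x) :=
    hp.has_fpower_series_dslope_fslope.analyticAt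
  refine ⟨dslope (f ∘ c.symm) (c x) ∘ c,
    hG.contDiffAt.contMDiffAt.comp x ((contMDiffOn_chart (I := 𝓘(ℂ)) (n := ω)
      (x := x)).contMDiffAt (c.open_source.mem_nhds hmem)), ?_⟩
  filter_upwards [c.open_source.mem_nhds hmem] with y hy
  have := sub_smul_dslope (f ∘ c.symm) (c x) (c y)
  simp only [Function.comp_apply, c.left_inv hy, c.left_inv hmem, smul_eq_mul] at this
  rw [← this, mul_comm, Function.comp_apply]

/-- A chart is a homeomorphism onto an open subset of `ℂ`, which has no isolated points. Hence there
are points arbitrarily near `x` where the coordinate difference can be cancelled. -/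
theorem not_eventually_chartAt_eq (x : X) :
    ¬ ∀ᶠ y in 𝓝 x, chartAt ℂ x y = chartAt ℂ x x := by
  intro h
  set c := chartAt ℂ x with hc
  have hmem : x ∈ c.source := mem_chart_source ℂ x
  have h1 : ∀ᶠ z in 𝓝 (c x), z = c x := by
    have ht : Filter.Tendsto c.symm (𝓝 (c x)) (𝓝 x) := by
      simpa [c.left_inv hmem] using (c.continuousAt_symm (c.map_source hmem)).tendsto
    filter_upwards [ht.eventually h, c.open_target.mem_nhds (c.map_source hmem)] with z hz hz'
    rwa [c.right_inv hz'] at hz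
  have h2 : ({c x} : Set ℂ) ∈ 𝓝 (c x) := h1
  exact not_isOpen_singleton (c x) (isOpen_singleton_iff_nhds_eq_pure _ |>.2
    ((Filter.le_pure_iff.2 h2).antisymm (pure_le_nhds _)))

/-- For an anti-holomorphic involution `σ`, the conjugate of a coordinate at `σ x`, composed
with `σ`, is a local coordinate at `x`. -/
theorem IsAntiholomorphic.exists_factor_chart [IsManifold 𝓘(ℂ) ω X] {σ : X → X}
    (hσ : IsAntiholomorphic σ) (hinv : Function.Involutive σ) (x : X) :
    ∃ h : X → ℂ, ContMDiffAt 𝓘(ℂ) 𝓘(ℂ) ω h x ∧ h x ≠ 0 ∧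
      ∀ᶠ y in 𝓝 x, conj (chartAt ℂ (σ x) (σ y) - chartAt ℂ (σ x) (σ x)) =
        h y * (chartAt ℂ x y - chartAt ℂ x x) := by
  obtain ⟨h, hh, he⟩ := exists_contMDiffAt_factor_chart (hσ.contMDiffAt_conj x)
  have hq : ContMDiffAt 𝓘(ℂ) 𝓘(ℂ) ω (fun y => conj (chartAt ℂ x (σ y))) (σ x) := by
    have := hσ.contMDiffAt_conj (σ x)
    rwa [hinv x] at this
  obtain ⟨k, hk, he'⟩ := exists_contMDiffAt_factor_chart hq
  refine ⟨h, hh, fun h0 => not_eventually_chartAt_eq x ?_, ?_⟩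
  -- Factoring in both directions and using `σ ∘ σ = id` gives `conj (k ∘ σ) * h = 1` wherever the
  -- coordinate difference is nonzero. If `h x = 0`, this product would stay away from `1` near `x`.
  · have hkc : ContinuousAt (fun y => conj (k (σ y)) * h y) x :=
      (Complex.continuous_conj.continuousAt.comp
        (hk.continuousAt.comp hσ.continuous.continuousAt)).mul hh.continuousAt
    have hne : ∀ᶠ y in 𝓝 x, conj (k (σ y)) * h y ≠ 1 :=
      hkc.eventually_ne (by simp [h0])
    filter_upwards [hne, he, hσ.continuous.continuousAt.eventually he'] with y h1 h2 h3
    have h4 := congrArg conj h3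
    simp only [hinv _, map_sub, map_mul, Complex.conj_conj] at h4 h2
    rw [h2] at h4
    by_contra hcon
    refine h1 (mul_right_cancel₀ (sub_ne_zero.2 hcon) ?_)
    rw [one_mul, mul_assoc, ← h4]
  · filter_upwards [he] with y hy
    rw [map_sub, hy]

end Coordinates

/-! ### Isomorphisms of line bundles in local trivializations -/

namespace HolomorphicLineBundle

variable {X : Type*} [TopologicalSpace X] [ChartedSpace ℂ X]

/-- A fibrewise map that is multiplication by a holomorphic function in local trivializations is
holomorphic. -/
theorem contMDiff_of_local_coefficient {L M : HolomorphicLineBundle X}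
    (f : ∀ x, L.Fiber x → M.Fiber x)
    (hf : ∀ x, ∃ u : X → ℂ, ContMDiffAt 𝓘(ℂ) 𝓘(ℂ) ω u x ∧ ∀ᶠ y in 𝓝 x, ∀ v : L.Fiber y,
      (trivializationAt ℂ M.Fiber x ⟨y, f y v⟩).2 =
        u y * (trivializationAt ℂ L.Fiber x ⟨y, v⟩).2) :
    ContMDiff (𝓘(ℂ).prod 𝓘(ℂ)) (𝓘(ℂ).prod 𝓘(ℂ)) ω
      (fun p : TotalSpace ℂ L.Fiber => (⟨p.1, f p.1 p.2⟩ : TotalSpace ℂ M.Fiber)) := by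
  intro p
  obtain ⟨u, hu, he⟩ := hf p.1
  have hproj : ContMDiffAt (𝓘(ℂ).prod 𝓘(ℂ)) 𝓘(ℂ) ω (π ℂ L.Fiber) p := contMDiffAt_proj L.Fiber
  refine contMDiffAt_totalSpace.2 ⟨hproj, ?_⟩
  have hid : ContMDiffAt (𝓘(ℂ).prod 𝓘(ℂ)) 𝓘(ℂ) ω
      (fun q : TotalSpace ℂ L.Fiber => (trivializationAt ℂ L.Fiber p.1 q).2) p :=
    (contMDiffAt_totalSpace.1 (contMDiffAt_id (x := p))).2
  have hu' : ContMDiffAt (𝓘(ℂ).prod 𝓘(ℂ)) 𝓘(ℂ) ω (u ∘ π ℂ L.Fiber) p := hu.comp p hproj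
  refine (hu'.mul hid).congr_of_eventuallyEq ?_
  filter_upwards [hproj.continuousAt.eventually he] with q hq
  exact hq q.2

namespace Iso

variable {L M N : HolomorphicLineBundle X}

/-- Fiberwise linear isomorphisms given in local trivializations by multiplication with
nonvanishing holomorphic functions form an isomorphism of holomorphic line bundles. -/
noncomputable def ofLocalCoefficient (f : ∀ x, L.Fiber x ≃ₗ[ℂ] M.Fiber x)
    (hf : ∀ x, ∃ u : X → ℂ, ContMDiffAt 𝓘(ℂ) 𝓘(ℂ) ω u x ∧ u x ≠ 0 ∧
      ∀ᶠ y in 𝓝 x, ∀ v : L.Fiber y,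
        (trivializationAt ℂ M.Fiber x ⟨y, f y v⟩).2 =
          u y * (trivializationAt ℂ L.Fiber x ⟨y, v⟩).2) : L.Iso M where
  fiberEquiv := f
  holomorphic_toFun := contMDiff_of_local_coefficient (fun x => f x) fun x =>
    let ⟨u, hu, _, he⟩ := hf x
    ⟨u, hu, he⟩
  holomorphic_invFun := contMDiff_of_local_coefficient (fun x => (f x).symm) fun x => by
    obtain ⟨u, hu, h0, he⟩ := hf x
    refine ⟨fun y => (u y)⁻¹, hu.inv₀ h0, ?_⟩
    filter_upwards [he, hu.continuousAt.eventually_ne h0] with y hy hy0 v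
    have := hy ((f y).symm v)
    rw [LinearEquiv.apply_symm_apply] at this
    rw [this, inv_mul_cancel_left₀ hy0]

/-- Converse to `ofLocalCoefficient`. The fibers are lines, so `φ` is determined by the image of the
local frame `e.symm y 1`; the coefficient is the coordinate of that image. -/
theorem exists_local_coefficient (φ : L.Iso M) (x : X) :
    ∃ u : X → ℂ, ContMDiffAt 𝓘(ℂ) 𝓘(ℂ) ω u x ∧ u x ≠ 0 ∧
      ∀ᶠ y in 𝓝 x, ∀ v : L.Fiber y,
        (trivializationAt ℂ M.Fiber x ⟨y, φ.fiberEquiv y v⟩).2 =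
          u y * (trivializationAt ℂ L.Fiber x ⟨y, v⟩).2 := by
  set e := trivializationAt ℂ L.Fiber x
  set e' := trivializationAt ℂ M.Fiber x
  have hx : x ∈ e.baseSet := mem_baseSet_trivializationAt ℂ L.Fiber x
  have hx' : x ∈ e'.baseSet := mem_baseSet_trivializationAt ℂ M.Fiber x
  have hs : ContMDiffAt 𝓘(ℂ) (𝓘(ℂ).prod 𝓘(ℂ)) ω
      (fun y => TotalSpace.mk' ℂ y (e.symm y 1)) x := by
    rw [contMDiffAt_section]
    refine (contMDiffAt_const (c := (1 : ℂ))).congr_of_eventuallyEq ?_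
    filter_upwards [e.open_baseSet.mem_nhds hx] with y hy
    exact congrArg Prod.snd (e.apply_mk_symm hy 1)
  have hcomp : ContMDiffAt 𝓘(ℂ) (𝓘(ℂ).prod 𝓘(ℂ)) ω
      (fun y => TotalSpace.mk' ℂ y (φ.fiberEquiv y (e.symm y 1))) x :=
    (φ.holomorphic_toFun.contMDiffAt).comp x hs
  have key : ∀ y ∈ e.baseSet ∩ e'.baseSet, ∀ v : L.Fiber y,
      (e' ⟨y, φ.fiberEquiv y v⟩).2 =
        (e' ⟨y, φ.fiberEquiv y (e.symm y 1)⟩).2 * (e ⟨y, v⟩).2 := by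
    intro y hy v
    have h1 : v = (e ⟨y, v⟩).2 • e.symm y 1 := by
      have h2 : e.symm y (e ⟨y, v⟩).2 = v := e.symm_apply_apply_mk hy.1 v
      have h3 := (e.symmL ℂ y).map_smul (e ⟨y, v⟩).2 1
      rw [e.symmL_apply hy.1, e.symmL_apply hy.1, smul_eq_mul, mul_one, h2] at h3
      exact h3
    have h4 := (e'.linear ℂ hy.2).map_smul (e ⟨y, v⟩).2 (φ.fiberEquiv y (e.symm y 1))
    rw [← map_smul, ← h1] at h4
    rw [h4, smul_eq_mul, mul_comm]
  refine ⟨_, (contMDiffAt_section x).1 hcomp, ?_, ?_⟩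
  -- A zero coefficient would make `φ` vanish on the fiber over `x`, but it hits the vector with
  -- coordinate `1`.
  · intro h0
    have := key x ⟨hx, hx'⟩ ((φ.fiberEquiv x).symm (e'.symm x 1))
    rw [LinearEquiv.apply_symm_apply, h0, zero_mul, e'.apply_mk_symm hx'] at this
    exact one_ne_zero this
  · filter_upwards [(e.open_baseSet.inter e'.open_baseSet).mem_nhds ⟨hx, hx'⟩] with y hy
    exact key y hy

/-- The composition of two isomorphisms of holomorphic line bundles. -/
def trans (φ : L.Iso M) (ψ : M.Iso N) : L.Iso N where
  fiberEquiv x := (φ.fiberEquiv x).trans (ψ.fiberEquiv x)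
  holomorphic_toFun := ψ.holomorphic_toFun.comp φ.holomorphic_toFun
  holomorphic_invFun := φ.holomorphic_invFun.comp ψ.holomorphic_invFun

variable [IsManifold 𝓘(ℂ) ω X]

/-- A complex linear isomorphism, as one between the conjugate vector spaces. -/
noncomputable def conjPullbackFiberEquiv (φ : L.Iso M) (σ : C(X, X))
    (hσ : IsAntiholomorphic σ) (x : X) :
    (L.conjPullback σ hσ).Fiber x ≃ₗ[ℂ] (M.conjPullback σ hσ).Fiber x where
  toFun v := φ.fiberEquiv (σ x) v
  invFun v := (φ.fiberEquiv (σ x)).symm v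
  map_add' v w := (φ.fiberEquiv (σ x)).map_add v w
  -- On both conjugate fibers `c` acts as `conj c`.
  map_smul' c v := (φ.fiberEquiv (σ x)).map_smul (conj c) v
  left_inv v := (φ.fiberEquiv (σ x)).left_inv v
  right_inv v := (φ.fiberEquiv (σ x)).right_inv v

/-- Isomorphic line bundles have isomorphic pulled back conjugates. -/
noncomputable def conjPullback (φ : L.Iso M) (σ : C(X, X)) (hσ : IsAntiholomorphic σ) :
    (L.conjPullback σ hσ).Iso (M.conjPullback σ hσ) :=
  ofLocalCoefficient (φ.conjPullbackFiberEquiv σ hσ) fun x => by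
    obtain ⟨u, hu, h0, he⟩ := φ.exists_local_coefficient (σ x)
    refine ⟨fun y => conj (u (σ y)), hσ.contMDiffAt_conj_comp hu,
      (map_ne_zero (starRingEnd ℂ)).2 h0, ?_⟩
    filter_upwards [hσ.continuous.continuousAt.eventually he] with y hy v
    exact (congrArg conj (hy v)).trans (map_mul _ _ _)

end Iso

end HolomorphicLineBundle

/-! ### The pulled back conjugate of the line bundle of a divisor -/

namespace RiemannDivisor

variable {X : Type*}

theorem map_apply {σ : X → X} (hinv : Function.Involutive σ) (D : RiemannDivisor X) (x : X) :
    D.map σ x = D (σ x) := by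
  conv_lhs => rw [← hinv x]
  exact Finsupp.mapDomain_apply hinv.injective D (σ x)

variable [TopologicalSpace X] [ChartedSpace ℂ X]

/-- The local equation at `y` is `0 ^ 0 = 1` at `y` itself, so the denominator drops out. -/
theorem transition_eq_localEq_of_apply_eq_zero {D : RiemannDivisor X} {i y : X} (hiy : y ≠ i)
    (hD : D y = 0) : D.transition y i y = D.localEq i y := by
  simp [transition, hiy, localEq, hD]

theorem transition_self (D : RiemannDivisor X) (i y : X) : D.transition i i y = 1 := by
  simp [transition]

theorem eventually_apply_eq_zero [T1Space X] (D : RiemannDivisor X) (x : X) :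
    ∀ᶠ y in 𝓝 x, y ≠ x → D y = 0 := by
  filter_upwards [(D.isOpen_nbhd x).mem_nhds (D.mem_nbhd_self x)] with y hy hyx
  by_contra h
  exact hy.2 ⟨by simpa using h, hyx⟩

variable [T1Space X] [IsManifold 𝓘(ℂ) ω X]

/-- The fiber over `y` is `ℂ`, read in the coordinate of index `y`; the transition function moves it
to index `x`. -/
theorem trivializationAt_lineBundle_snd (D : RiemannDivisor X) (x y : X)
    (v : D.lineBundle.Fiber y) :
    (trivializationAt ℂ D.lineBundle.Fiber x ⟨y, v⟩).2 = (show ℂ from v) * D.transition y x y :=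
  rfl

theorem trivializationAt_conjPullback_lineBundle_snd (D : RiemannDivisor X) (σ : C(X, X))
    (hσ : IsAntiholomorphic σ) (x y : X) (v : (D.lineBundle.conjPullback σ hσ).Fiber y) :
    (trivializationAt ℂ (D.lineBundle.conjPullback σ hσ).Fiber x ⟨y, v⟩).2 =
      conj ((show ℂ from v) * D.transition (σ y) (σ x) (σ y)) :=
  rfl

/-- The complex linear isomorphism `v ↦ c * conj v` from a fiber of `σ^* 𝒪_X(D)‾` to one of
`𝒪_X(σ(D))`. -/
noncomputable def conjPullbackFiberEquiv (D : RiemannDivisor X) (σ : C(X, X))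
    (hσ : IsAntiholomorphic σ) (x : X) {c : ℂ} (hc : c ≠ 0) :
    (D.lineBundle.conjPullback σ hσ).Fiber x ≃ₗ[ℂ] (D.map σ).lineBundle.Fiber x where
  toFun v := (c * conj (show ℂ from v) : ℂ)
  invFun w := (conj (c⁻¹ * (show ℂ from w)) : ℂ)
  map_add' v w := (congrArg (c * ·) (map_add conj (show ℂ from v) (show ℂ from w))).trans
    (mul_add c _ _)
  map_smul' a v := by
    change c * conj (conj a * (show ℂ from v)) = a * (c * conj (show ℂ from v))
    rw [map_mul, Complex.conj_conj, mul_left_comm]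
  left_inv v := by
    change conj (c⁻¹ * (c * conj (show ℂ from v))) = (show ℂ from v)
    rw [inv_mul_cancel_left₀ hc, Complex.conj_conj]
  right_inv w := by
    change c * conj (conj (c⁻¹ * (show ℂ from w))) = (show ℂ from w)
    rw [Complex.conj_conj, mul_inv_cancel_left₀ hc]

/-- `σ^* 𝒪_X(D)‾` is isomorphic to `𝒪_X(σ(D))`, for `σ` an anti-holomorphic involution. -/
theorem nonempty_iso_conjPullback_lineBundle (D : RiemannDivisor X) (σ : C(X, X))
    (hσ : IsAntiholomorphic σ) (hinv : Function.Involutive σ) :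
    Nonempty ((D.lineBundle.conjPullback σ hσ).Iso (D.map σ).lineBundle) := by
  choose h hh h0 he using hσ.exists_factor_chart hinv
  -- Each fiber is read in the coordinate of its own base point, so the scalar over `x` is the value
  -- at `x` of the coefficient `h x ^ (-D (σ x))`. It is `1` when `D (σ x) = 0`.
  refine ⟨HolomorphicLineBundle.Iso.ofLocalCoefficient
    (fun x => D.conjPullbackFiberEquiv σ hσ x (zpow_ne_zero (-D (σ x)) (h0 x))) fun x => ?_⟩
  have hpow : AnalyticAt ℂ (fun z : ℂ => z ^ (-D (σ x))) (h x x) := analyticAt_id.zpow (h0 x)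
  refine ⟨fun y => h x y ^ (-D (σ x)), hpow.contDiffAt.contMDiffAt.comp x (hh x),
    zpow_ne_zero _ (h0 x), ?_⟩
  filter_upwards [he x, (D.map σ).eventually_apply_eq_zero x,
    (hh x).continuousAt.eventually_ne (h0 x)] with y hy hD hy0 v
  rw [trivializationAt_lineBundle_snd, trivializationAt_conjPullback_lineBundle_snd]
  suffices H : ∀ w : ℂ, h y y ^ (-D (σ y)) * conj w * (D.map σ).transition y x y =
      h x y ^ (-D (σ x)) * conj (w * D.transition (σ y) (σ x) (σ y)) from H v
  intro w
  -- At `x` the transitions are `1`. At other nearby points `D (σ y) = 0`, so the scalar is `1`, the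
  -- transitions are local equations, and the claim is the factorization `hy` raised to the power `D
  -- (σ x)`.
  by_cases hyx : y = x
  · subst hyx
    simp only [transition_self, mul_one]
  · have hD' := hD hyx
    have hDσ : D (σ y) = 0 := by rwa [map_apply hinv] at hD'
    rw [transition_eq_localEq_of_apply_eq_zero hyx hD',
      transition_eq_localEq_of_apply_eq_zero (hinv.injective.ne hyx) hDσ, hDσ, localEq, localEq,
      map_apply hinv, map_mul, map_zpow₀, hy, mul_zpow, neg_zero, zpow_zero, one_mul,
      zpow_neg, mul_left_comm (conj w), inv_mul_cancel_left₀ (zpow_ne_zero _ hy0)]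

end RiemannDivisor

theorem mainTheorem6 {X : Type*} [TopologicalSpace X] [T2Space X] [ChartedSpace ℂ X]
    [IsManifold 𝓘(ℂ) ω X]
    (σ : C(X, X)) (hσ : IsAntiholomorphic σ) (hinv : Function.Involutive σ)
    (D : RiemannDivisor X) (L : HolomorphicLineBundle X)
    (hL : Nonempty (L.Iso D.lineBundle)) :
    Nonempty ((L.conjPullback σ hσ).Iso (D.map σ).lineBundle) := by
  obtain ⟨φ⟩ := hL
  obtain ⟨ψ⟩ := D.nonempty_iso_conjPullback_lineBundle σ hσ hinv
  exact ⟨(φ.conjPullback σ hσ).trans ψ⟩
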